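/- Let $T\subseteq\mathbb R^m$ be compact, $x\in\mathbb R^k$, $X_1,\dots,X_k\subseteq\mathbb R^m$, $\mu\in\mathbb R^m$, $\Sigma\in\mathbb R^{m\times m}$ symmetric positive semidefinite, $\varepsilon_\mu>0$, $\varepsilon_\Sigma\ge 1$, and let $I$ be a finite index set with sets $T_i\subseteq\mathbb R^m$ and numbers $\varepsilon_i\in\mathbb R$ $(i\in I)$. Let $\mathbb 1^c_{X_i},\mathbb 1^c_{T_i}$ be continuous real functions on $T$ such that, on $T$, $\mathbb 1^c_{X_i}\ge\mathbb 1_{X_i}$ if $x_i\ge0$, $\mathbb 1^c_{X_i}\le\mathbb 1_{X_i}$ if $x_i<0$, $\mathbb 1^c_{T_i}\le\mathbb 1_{T_i}$ if $\varepsilon_i\ge 0$, and $\mathbb 1^c_{T_i}\ge\mathbb 1_{T_i}$ if $\varepsilon_i<0$. Assume that $1,2\in I$ with $T_1=T_2=T$, $\varepsilon_1=-1$, $\varepsilon_2=1$ and $\mathbb 1^c_{T_1}=\mathbb 1^c_{T_2}=1$ on $T$. Write $\langle f,\mathbb P\rangle=\int_T f\,d\mathbb P$ (entrywise for matrix-valued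 $f$), $\langle A,B\rangle=\operatorname{tr}(A^\top B)$ for matrices, $\operatorname{sign}(0)=0$, and $$A_1(t)=\begin{bmatrix}\Sigma & t-\mu\\ (t-\mu)^\top & \varepsilon_\mu\end{bmatrix},\qquad A_2(t)=-(t-\mu)(t-\mu)^\top .$$ The primal problem is to minimize $\big\langle\sum_{i=1}^k x_i\mathbb 1^c_{X_i},\mathbb P\big\rangle$ over all nonnegative Radon measures $\mathbb P$ on $T$ subject to $$\langle A_1,\mathbb P\rangle\succeq0,\qquad \langle A_2,\mathbb P\rangle\succeq-\varepsilon_\Sigma\Sigma,\qquad \langle\operatorname{sign}(\varepsilon_i)\mathbb 1^c_{T_i},\mathbb P\rangle\ge\varepsilon_i\quad(i\in I).$$ The dual problem is to maximize $\sum_{i\in I}\varepsilon_iy_i-\varepsilon_\Sigma\langle\Sigma,Y_2\rangle$ over symmetric positive semidefinite $Y_1\in\mathbb R^{(m+1)\times(m+1)}$, $Y_2\in\mathbb R^{m\times m}$ and $y\in\mathbb R^I_{\ge0}$ subject to $$\sum_{i=1}^kx_i\mathbb 1^c_{X_i}(t)-\langle A_1(t),Y_1\rangle-\langle A_2(t),Y_2\rangle-\sum_{i\in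 I}\operatorname{sign}(\varepsilon_i)\mathbb 1^c_{T_i}(t)\,y_i\ge0\quad\text{for all }t\in T .$$ Suppose that the Gaussian probability measure on $T$ with parameters $(\mu,\Sigma)$, i.e. the law $\mathcal N(\mu,\Sigma)$ conditioned on $T$ (which is $\mathcal N(\mu,\Sigma)$ itself if that law is concentrated on $T$), is strictly positive (every nonempty relatively open subset of $T$ has positive measure) and feasible for the primal problem. Then the duality gap is zero: the optimal values (infimum and supremum) of the primal and the dual problem are finite and equal. -/

import Mathlib

open MeasureTheory ProbabilityTheory Matrix

noncomputable section

namespace MomentDRO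

/-- The data of a moment / confidence-set problem on a domain `T ⊆ ℝᵐ`: a simple function
`∑ᵢ xᵢ 1_{Xᵢ}`, the nominal mean `μ` and covariance `S`, the radii `εμ`, `εS`, the confidence sets
`confSet i` with levels `ε i`, and continuous functions `Xc i`, `Tc i` on `T` that approximate the
indicator functions of `X i` and of `confSet i`. -/
structure Data (m k : ℕ) (ι : Type*) where
  T : Set (EuclideanSpace ℝ (Fin m))
  x : Fin k → ℝ
  X : Fin k → Set (EuclideanSpace ℝ (Fin m))
  Xc : Fin k → C(T, ℝ)
  μ : EuclideanSpace ℝ (Fin m)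
  S : Matrix (Fin m) (Fin m) ℝ
  εμ : ℝ
  εS : ℝ
  confSet : ι → Set (EuclideanSpace ℝ (Fin m))
  ε : ι → ℝ
  Tc : ι → C(T, ℝ)

/-- `g` dominates the indicator function of `A` on `T`. -/
def IsUpperApprox {m : ℕ} {T : Set (EuclideanSpace ℝ (Fin m))} (g : C(T, ℝ))
    (A : Set (EuclideanSpace ℝ (Fin m))) : Prop :=
  ∀ t : T, A.indicator (fun _ => (1 : ℝ)) (t : EuclideanSpace ℝ (Fin m)) ≤ g t

/-- `g` is dominated by the indicator function of `A` on `T`. -/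
def IsLowerApprox {m : ℕ} {T : Set (EuclideanSpace ℝ (Fin m))} (g : C(T, ℝ))
    (A : Set (EuclideanSpace ℝ (Fin m))) : Prop :=
  ∀ t : T, g t ≤ A.indicator (fun _ => (1 : ℝ)) (t : EuclideanSpace ℝ (Fin m))

/-- The pairing `⟨A, P⟩` of a matrix-valued function with a measure (entrywise integral). -/
def matIntegral {T n : Type*} [MeasurableSpace T] (A : T → Matrix n n ℝ) (P : Measure T) :
    Matrix n n ℝ :=
  Matrix.of fun i j => ∫ t, A t i j ∂P

/-- The Frobenius inner product `⟨A, B⟩ = tr (Aᵀ B)`. -/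
def frob {n : Type*} [Fintype n] (A B : Matrix n n ℝ) : ℝ := (Aᵀ * B).trace

namespace Data

variable {m k : ℕ} {ι : Type*} (D : Data m k ι)

/-- The objective function `∑ᵢ xᵢ 1ᶜ_{Xᵢ}` on `T`. -/
def objective (t : D.T) : ℝ := ∑ i, D.x i * D.Xc i t

/-- The vector `t - μ`. -/
def dev (t : D.T) : Fin m → ℝ := fun j => (t : EuclideanSpace ℝ (Fin m)) j - D.μ j

/-- The block matrix `[[Σ, t - μ], [(t - μ)ᵀ, ε_μ]]`. -/
def firstMoment (t : D.T) : Matrix (Fin m ⊕ Unit) (Fin m ⊕ Unit) ℝ :=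
  Matrix.fromBlocks D.S (Matrix.replicateCol Unit (D.dev t)) (Matrix.replicateRow Unit (D.dev t))
    (Matrix.of fun _ _ => D.εμ)

/-- The matrix `-(t - μ)(t - μ)ᵀ`. -/
def secondMoment (t : D.T) : Matrix (Fin m) (Fin m) ℝ :=
  -Matrix.vecMulVec (D.dev t) (D.dev t)

/-- The function `sign(εᵢ) 1ᶜ_{Tᵢ}` on `T`. -/
def confFun (i : ι) (t : D.T) : ℝ := Real.sign (D.ε i) * D.Tc i t

/-- Feasibility for the primal problem. For compact `T` the nonnegative Radon measures on `T` are
exactly the finite Borel measures. -/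
def PrimalFeasible (P : Measure D.T) : Prop :=
  IsFiniteMeasure P ∧
  (matIntegral D.firstMoment P).PosSemidef ∧
  (matIntegral D.secondMoment P - (-(D.εS • D.S))).PosSemidef ∧
  ∀ i, D.ε i ≤ ∫ t, D.confFun i t ∂P

/-- The optimal value of the primal minimization problem. -/
def primalValue : EReal :=
  ⨅ (P : Measure D.T) (_ : D.PrimalFeasible P), ((∫ t, D.objective t ∂P : ℝ) : EReal)

/-- The Gaussian probability measure `N(μ, Σ)` on the domain `T`: the law `N(μ, Σ)` on `ℝᵐ`
conditioned on `T`, as a measure on `T`. It is the restriction of `N(μ, Σ)` to `T` when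
`N(μ, Σ)` gives full mass to `T`. -/
def gaussianOn : Measure D.T :=
  (ProbabilityTheory.cond (multivariateGaussian D.μ D.S) D.T).comap Subtype.val

variable [Fintype ι]

/-- Feasibility for the dual problem: the dual slack is a nonnegative function on `T` (it is a
continuous function of `t` by its form), and the multipliers lie in the respective cones. -/
def DualFeasible (Y₁ : Matrix (Fin m ⊕ Unit) (Fin m ⊕ Unit) ℝ) (Y₂ : Matrix (Fin m) (Fin m) ℝ)
    (y : ι → ℝ) : Prop :=
  Y₁.PosSemidef ∧ Y₂.PosSemidef ∧ (∀ i, 0 ≤ y i) ∧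
  ∀ t : D.T, 0 ≤ D.objective t - frob (D.firstMoment t) Y₁ - frob (D.secondMoment t) Y₂
    - ∑ i, D.confFun i t * y i

/-- The objective `∑ᵢ εᵢ yᵢ - ε_Σ ⟨Σ, Y₂⟩` of the dual problem. -/
def dualObjective (Y₂ : Matrix (Fin m) (Fin m) ℝ) (y : ι → ℝ) : ℝ :=
  ∑ i, D.ε i * y i - D.εS * frob D.S Y₂

/-- The optimal value of the dual maximization problem. -/
def dualValue : EReal :=
  ⨆ (Y₁ : Matrix (Fin m ⊕ Unit) (Fin m ⊕ Unit) ℝ) (Y₂ : Matrix (Fin m) (Fin m) ℝ) (y : ι → ℝ)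
    (_ : D.DualFeasible Y₁ Y₂ y), ((D.dualObjective Y₂ y : ℝ) : EReal)

end Data

end MomentDRO

end

/-!
Weak duality follows by integrating the dual slack against a primal feasible measure, because the
cone of positive semidefinite matrices pairs nonnegatively with itself
(`MomentDRO.Data.dualObjective_le_integral_objective`).

For the converse, no interior point of the feasible set is needed. The confidence constraints with
set `T` and levels `-1` and `1` force every feasible measure to be a probability measure, and the
space of probability measures on the compact set `T` is weakly compact. Hence the values
`(⟨A₁, P⟩, ⟨A₂, P⟩, (⟨sign(εᵢ) 1ᶜ_{Tᵢ}, P⟩)ᵢ, ⟨objective, P⟩)` at probability measures `P` form a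
compact convex subset of a finite-dimensional space. If `w` is below the primal value, this set is
disjoint from the closed convex set of values that meet the constraints and have last coordinate at
most `w`, so a linear functional separates the two strictly. The recession directions of the closed
set put the matrix and vector coefficients of the functional into the dual cones. The coefficient
of the objective is positive because there is a feasible measure, here the Gaussian one. After
division by it, evaluation at Dirac measures gives the dual slack inequality up to an additive
constant, and the multipliers of the two mass constraints absorb this constant without changing the
balance between slack and dual objective. The result is a dual feasible point with objective value
exactly `w` (`MomentDRO.Data.exists_dualFeasible_dualObjective_eq`). The primal value is finite
since the objective function is bounded on `T`.
-/

namespace MomentDRO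

/-! ### The Frobenius inner product and the cone of positive semidefinite matrices -/

section Frobenius

variable {n : Type*} [Fintype n]

lemma frob_eq_sum (A B : Matrix n n ℝ) : frob A B = ∑ i, ∑ j, A i j * B i j := by
  rw [frob, trace, Finset.sum_comm]
  simp [mul_apply]

lemma frob_comm (A B : Matrix n n ℝ) : frob A B = frob B A := by
  simp only [frob_eq_sum, mul_comm]

lemma frob_add_left (A A' B : Matrix n n ℝ) : frob (A + A') B = frob A B + frob A' B := by
  simp [frob, add_mul]

lemma frob_smul_left (c : ℝ) (A B : Matrix n n ℝ) : frob (c • A) B = c * frob A B := by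
  simp [frob]

lemma frob_neg_left (A B : Matrix n n ℝ) : frob (-A) B = -frob A B := by
  simp [frob]

lemma frob_add_right (A B B' : Matrix n n ℝ) : frob A (B + B') = frob A B + frob A B' := by
  simp [frob, mul_add]

lemma frob_smul_right (c : ℝ) (A B : Matrix n n ℝ) : frob A (c • B) = c * frob A B := by
  simp [frob]

lemma frob_transpose_right {A : Matrix n n ℝ} (hA : A.IsHermitian) (B : Matrix n n ℝ) :
    frob A Bᵀ = frob A B := by
  have h : Aᵀ = A := by simpa using hA.eq
  rw [frob, frob, h, ← trace_transpose, transpose_mul, transpose_transpose, h, trace_mul_comm]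

lemma frob_vecMulVec_left (x : n → ℝ) (B : Matrix n n ℝ) :
    frob (vecMulVec x x) B = x ⬝ᵥ B *ᵥ x := by
  simp only [frob_eq_sum, vecMulVec_apply, dotProduct, mulVec, Finset.mul_sum]
  exact Finset.sum_congr rfl fun i _ => Finset.sum_congr rfl fun j _ => by ring

/-- The cone of positive semidefinite matrices is contained in its dual cone. -/
lemma frob_nonneg {A B : Matrix n n ℝ} (hA : A.PosSemidef) (hB : B.PosSemidef) :
    0 ≤ frob A B := by
  obtain ⟨r, v, rfl⟩ := posSemidef_iff_eq_sum_vecMulVec.mp hA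
  rw [frob, transpose_sum, Finset.sum_mul, trace_sum]
  refine Finset.sum_nonneg fun i _ => ?_
  have := hB.dotProduct_mulVec_nonneg (v i)
  rw [← frob, star_trivial, frob_vecMulVec_left]
  simpa using this

/-- The cone of positive semidefinite matrices contains its dual cone. Since the pairing with
positive semidefinite matrices does not see the antisymmetric part, the matrix has to be
symmetrized. -/
lemma posSemidef_add_transpose_of_frob_nonneg {G : Matrix n n ℝ}
    (hG : ∀ A : Matrix n n ℝ, A.PosSemidef → 0 ≤ frob A G) : (G + Gᵀ).PosSemidef := by
  refine .of_dotProduct_mulVec_nonneg (by simp [IsHermitian, add_comm]) fun x => ?_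
  have hx : (vecMulVec x x).PosSemidef := by
    simpa using posSemidef_vecMulVec_self_star (R := ℝ) x
  rw [star_trivial, ← frob_vecMulVec_left, frob_add_right, frob_transpose_right hx.1]
  linarith [hG _ hx]

/-- Every linear functional on a space of matrices is a Frobenius inner product. -/
lemma exists_frob_eq (f : Matrix n n ℝ →ₗ[ℝ] ℝ) :
    ∃ G : Matrix n n ℝ, ∀ A, f A = frob A G := by
  classical
  refine ⟨of fun i j => f (single i j 1), fun A => ?_⟩
  conv_lhs => rw [matrix_eq_sum_single A]
  rw [frob_eq_sum, map_sum]
  refine Finset.sum_congr rfl fun i _ => ?_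
  rw [map_sum]
  refine Finset.sum_congr rfl fun j _ => ?_
  rw [← mul_one (A i j), ← smul_eq_mul, ← smul_single, map_smul]
  simp

lemma isClosed_posSemidef : IsClosed {A : Matrix n n ℝ | A.PosSemidef} := by
  simp only [posSemidef_iff_dotProduct_mulVec, IsHermitian, Set.ofPred_and, Set.ofPred_forall]
  exact (isClosed_eq (by fun_prop) continuous_id).inter
    (isClosed_iInter fun x => isClosed_le continuous_const (by fun_prop))

end Frobenius

/-! ### Entrywise integrals and convex combinations of measures -/

section Integral

variable {α n : Type*} [MeasurableSpace α]

lemma frob_matIntegral [Fintype n] {A : α → Matrix n n ℝ} {P : Measure α}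
    (hA : ∀ i j, Integrable (fun t => A t i j) P) (Y : Matrix n n ℝ) :
    frob (matIntegral A P) Y = ∫ t, frob (A t) Y ∂P := by
  simp only [frob_eq_sum, matIntegral, of_apply]
  refine .symm <| (integral_finsetSum _ fun i _ =>
    integrable_finsetSum _ fun j _ => (hA i j).mul_const _).trans ?_
  refine Finset.sum_congr rfl fun i _ => ?_
  refine (integral_finsetSum _ fun j _ => (hA i j).mul_const _).trans ?_
  exact Finset.sum_congr rfl fun j _ => integral_mul_const _ _

lemma integral_convexComb {P Q : Measure α} {a b : ℝ} (ha : 0 ≤ a) (hb : 0 ≤ b) {f : α → ℝ}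
    (hP : Integrable f P) (hQ : Integrable f Q) :
    ∫ t, f t ∂(ENNReal.ofReal a • P + ENNReal.ofReal b • Q)
      = a * ∫ t, f t ∂P + b * ∫ t, f t ∂Q := by
  rw [integral_add_measure (hP.smul_measure ENNReal.ofReal_ne_top)
    (hQ.smul_measure ENNReal.ofReal_ne_top), integral_smul_measure, integral_smul_measure,
    ENNReal.toReal_ofReal ha, ENNReal.toReal_ofReal hb, smul_eq_mul, smul_eq_mul]

lemma isProbabilityMeasure_convexComb {P Q : Measure α} [IsProbabilityMeasure P]
    [IsProbabilityMeasure Q] {a b : ℝ} (ha : 0 ≤ a) (hb : 0 ≤ b) (hab : a + b = 1) :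
    IsProbabilityMeasure (ENNReal.ofReal a • P + ENNReal.ofReal b • Q) :=
  ⟨by simp [← ENNReal.ofReal_add ha hb, hab]⟩

end Integral

namespace Data

variable {m k : ℕ} {ι : Type*} (D : Data m k ι)

/-! ### Continuity and symmetry of the data -/

section Continuity

lemma continuous_objective : Continuous D.objective := by
  unfold objective; fun_prop

lemma continuous_confFun (i : ι) : Continuous (D.confFun i) := by
  unfold confFun; fun_prop

lemma continuous_dev : Continuous D.dev := by
  unfold dev; fun_prop

lemma continuous_firstMoment : Continuous D.firstMoment := by
  have := D.continuous_dev
  unfold firstMoment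
  exact continuous_const.matrix_fromBlocks (by fun_prop) (by fun_prop) continuous_const

lemma continuous_secondMoment : Continuous D.secondMoment := by
  have := D.continuous_dev
  unfold secondMoment
  exact (this.matrix_vecMulVec this).neg

lemma isHermitian_firstMoment (hS : D.S.PosSemidef) (t : D.T) :
    (D.firstMoment t).IsHermitian :=
  hS.1.fromBlocks (by ext; simp) (by ext; simp)

lemma isHermitian_secondMoment (t : D.T) : (D.secondMoment t).IsHermitian := by
  ext i j; simp [secondMoment, vecMulVec_apply, mul_comm]

variable {D} in
lemma integrable_of_continuous [CompactSpace D.T] {P : Measure D.T} [IsFiniteMeasure P]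
    {f : D.T → ℝ} (hf : Continuous f) : Integrable f P :=
  hf.integrable_of_hasCompactSupport (HasCompactSupport.of_compactSpace f)

end Continuity

/-! ### Weak duality -/

section WeakDuality

lemma integrable_firstMoment [CompactSpace D.T] (P : Measure D.T) [IsFiniteMeasure P]
    (i j : Fin m ⊕ Unit) : Integrable (fun t => D.firstMoment t i j) P :=
  integrable_of_continuous (D.continuous_firstMoment.matrix_elem i j)

lemma integrable_secondMoment [CompactSpace D.T] (P : Measure D.T) [IsFiniteMeasure P]
    (i j : Fin m) : Integrable (fun t => D.secondMoment t i j) P :=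
  integrable_of_continuous (D.continuous_secondMoment.matrix_elem i j)

variable {D}

/-- The two confidence constraints with set `T` and levels `-1` and `1` say that the total mass
is at most one and at least one. -/
lemma PrimalFeasible.isProbabilityMeasure {P : Measure D.T} (hP : D.PrimalFeasible P) {i₁ i₂ : ι}
    (hε₁ : D.ε i₁ = -1) (hε₂ : D.ε i₂ = 1) (hTc₁ : D.Tc i₁ = 1) (hTc₂ : D.Tc i₂ = 1) :
    IsProbabilityMeasure P := by
  have := hP.1
  have h₁ := hP.2.2.2 i₁
  have h₂ := hP.2.2.2 i₂
  simp [confFun, hε₁, hε₂, hTc₁, hTc₂, Real.sign_of_neg] at h₁ h₂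
  have h : P.real Set.univ = 1 := le_antisymm h₁ h₂
  exact ⟨by rwa [measureReal_def, ENNReal.toReal_eq_one_iff] at h⟩

variable [Fintype ι]

/-- Integrating the dual slack against a measure. -/
lemma integral_dualSlack [CompactSpace D.T] (P : Measure D.T) [IsFiniteMeasure P]
    (Y₁ : Matrix (Fin m ⊕ Unit) (Fin m ⊕ Unit) ℝ) (Y₂ : Matrix (Fin m) (Fin m) ℝ) (y : ι → ℝ) :
    ∫ t, (D.objective t - frob (D.firstMoment t) Y₁ - frob (D.secondMoment t) Y₂
        - ∑ i, D.confFun i t * y i) ∂P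
      = ∫ t, D.objective t ∂P - frob (matIntegral D.firstMoment P) Y₁
        - frob (matIntegral D.secondMoment P) Y₂ - ∑ i, (∫ t, D.confFun i t ∂P) * y i := by
  have h₁ : Continuous fun t => frob (D.firstMoment t) Y₁ := by
    have := D.continuous_firstMoment
    unfold frob; fun_prop
  have h₂ : Continuous fun t => frob (D.secondMoment t) Y₂ := by
    have := D.continuous_secondMoment
    unfold frob; fun_prop
  have h₀ := D.continuous_objective
  have h₃ := D.continuous_confFun
  rw [integral_sub (integrable_of_continuous (by fun_prop))
      (integrable_of_continuous (by fun_prop)),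
    integral_sub (integrable_of_continuous (by fun_prop)) (integrable_of_continuous h₂),
    integral_sub (integrable_of_continuous h₀) (integrable_of_continuous h₁),
    frob_matIntegral (D.integrable_firstMoment P), frob_matIntegral (D.integrable_secondMoment P),
    integral_finsetSum _ fun i _ => integrable_of_continuous ((h₃ i).mul_const _)]
  simp only [integral_mul_const]

/-- Weak duality. -/
lemma dualObjective_le_integral_objective [CompactSpace D.T] {P : Measure D.T}
    (hP : D.PrimalFeasible P) {Y₁ : Matrix (Fin m ⊕ Unit) (Fin m ⊕ Unit) ℝ}
    {Y₂ : Matrix (Fin m) (Fin m) ℝ} {y : ι → ℝ} (hY : D.DualFeasible Y₁ Y₂ y) :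
    D.dualObjective Y₂ y ≤ ∫ t, D.objective t ∂P := by
  obtain ⟨_, hA₁, hA₂, hb⟩ := hP
  obtain ⟨hY₁, hY₂, hy, hslack⟩ := hY
  have h := integral_nonneg (μ := P) (Pi.le_def.2 hslack)
  rw [integral_dualSlack] at h
  have h₁ := frob_nonneg hA₁ hY₁
  have h₂ := frob_nonneg hA₂ hY₂
  rw [sub_neg_eq_add, frob_add_left, frob_smul_left] at h₂
  have h₃ : ∑ i, D.ε i * y i ≤ ∑ i, (∫ t, D.confFun i t ∂P) * y i :=
    Finset.sum_le_sum fun i _ => mul_le_mul_of_nonneg_right (hb i) (hy i)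
  unfold dualObjective
  linarith

end WeakDuality

/-! ### Separation and strong duality -/

section StrongDuality

/-- Matrices carry the product topology; this makes Hahn-Banach separation available for them. -/
instance {n : Type*} : LocallyConvexSpace ℝ (Matrix n n ℝ) :=
  inferInstanceAs (LocallyConvexSpace ℝ (n → n → ℝ))

/-- The values of the constraint functions and of the objective function of the primal problem
at a measure. -/
noncomputable def momentMap (P : Measure D.T) :
    Matrix (Fin m ⊕ Unit) (Fin m ⊕ Unit) ℝ × Matrix (Fin m) (Fin m) ℝ × (ι → ℝ) × ℝ :=
  (matIntegral D.firstMoment P, matIntegral D.secondMoment P, fun i => ∫ t, D.confFun i t ∂P,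
    ∫ t, D.objective t ∂P)

/-- The values of constraint and objective functions that meet the primal constraints and have
objective value at most `w`. -/
def sublevel (w : ℝ) :
    Set (Matrix (Fin m ⊕ Unit) (Fin m ⊕ Unit) ℝ × Matrix (Fin m) (Fin m) ℝ × (ι → ℝ) × ℝ) :=
  {p | p.1.PosSemidef ∧ (p.2.1 - (-(D.εS • D.S))).PosSemidef ∧ (∀ i, D.ε i ≤ p.2.2.1 i) ∧
    p.2.2.2 ≤ w}

/-- The values attained at probability measures form a compact set, because the space of
probability measures on a compact space is compact for weak convergence. -/
lemma isCompact_momentMap [CompactSpace D.T] :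
    IsCompact (Set.range fun P : ProbabilityMeasure D.T => D.momentMap P) := by
  refine isCompact_range ?_
  have key {f : D.T → ℝ} (hf : Continuous f) :
      Continuous fun P : ProbabilityMeasure D.T => ∫ t, f t ∂(P : Measure D.T) :=
    ProbabilityMeasure.continuous_integral_continuousMap (⟨f, hf⟩ : C(D.T, ℝ))
  refine .prodMk ?_ (.prodMk ?_ (.prodMk ?_ (key D.continuous_objective)))
  · exact continuous_matrix fun i j => key (D.continuous_firstMoment.matrix_elem i j)
  · exact continuous_matrix fun i j => key (D.continuous_secondMoment.matrix_elem i j)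
  · exact continuous_pi fun i => key (D.continuous_confFun i)

lemma convex_momentMap [CompactSpace D.T] :
    Convex ℝ (Set.range fun P : ProbabilityMeasure D.T => D.momentMap P) := by
  rintro _ ⟨P, rfl⟩ _ ⟨Q, rfl⟩ a b ha hb hab
  have key {f : D.T → ℝ} (hf : Continuous f) :=
    integral_convexComb (P := (P : Measure D.T)) (Q := Q) ha hb
      (integrable_of_continuous hf) (integrable_of_continuous hf)
  refine ⟨⟨_, isProbabilityMeasure_convexComb (P := P) (Q := Q) ha hb hab⟩, ?_⟩
  refine Prod.ext ?_ (Prod.ext ?_ (Prod.ext ?_ (key D.continuous_objective)))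
  · ext i j
    exact key (D.continuous_firstMoment.matrix_elem i j)
  · ext i j
    exact key (D.continuous_secondMoment.matrix_elem i j)
  · ext i
    exact key (D.continuous_confFun i)

lemma isClosed_sublevel (w : ℝ) : IsClosed (D.sublevel w) := by
  simp only [sublevel, Set.ofPred_and, Set.ofPred_forall]
  refine .inter (isClosed_posSemidef.preimage continuous_fst) (.inter
    (isClosed_posSemidef.preimage (by fun_prop)) (.inter
    (isClosed_iInter fun i => isClosed_le continuous_const (by fun_prop))
    (isClosed_le (by fun_prop) continuous_const)))

lemma convex_sublevel (w : ℝ) : Convex ℝ (D.sublevel w) := by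
  rintro ⟨A, B, c, r⟩ ⟨hA, hB, hc, hr⟩ ⟨A', B', c', r'⟩ ⟨hA', hB', hc', hr'⟩ a b ha hb hab
  refine ⟨(hA.smul ha).add (hA'.smul hb), ?_, fun i => ?_, ?_⟩
  · convert (hB.smul ha).add (hB'.smul hb) using 1
    obtain rfl : b = 1 - a := by linarith
    ext i j
    simp
    ring
  · have h₁ := mul_le_mul_of_nonneg_left (hc i) ha
    have h₂ := mul_le_mul_of_nonneg_left (hc' i) hb
    obtain rfl : b = 1 - a := by linarith
    simp at h₁ h₂ ⊢
    linarith
  · have h₁ := mul_le_mul_of_nonneg_left hr ha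
    have h₂ := mul_le_mul_of_nonneg_left hr' hb
    obtain rfl : b = 1 - a := by linarith
    simp at h₁ h₂ ⊢
    linarith

variable {D} [Fintype ι]

/-- A linear functional bounded above along a ray does not increase along it. -/
lemma nonpos_of_forall_add_mul_lt {a b u : ℝ} (h : ∀ s : ℝ, 0 ≤ s → a + s * b < u) : b ≤ 0 := by
  by_contra! hb
  have h₀ := h 0 le_rfl
  have := h ((u - a) / b) (div_nonneg (by linarith) hb.le)
  rw [div_mul_cancel₀ _ hb.ne'] at this
  linarith

/-- The coordinates of a linear functional on the space of values of constraint and objective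
functions. -/
lemma exists_coordinates
    (f : (Matrix (Fin m ⊕ Unit) (Fin m ⊕ Unit) ℝ × Matrix (Fin m) (Fin m) ℝ × (ι → ℝ) × ℝ)
      →ₗ[ℝ] ℝ) :
    ∃ (G₁ : Matrix (Fin m ⊕ Unit) (Fin m ⊕ Unit) ℝ) (G₂ : Matrix (Fin m) (Fin m) ℝ)
      (g : ι → ℝ) (l : ℝ), ∀ A B c r,
        f (A, B, c, r) = frob A G₁ + frob B G₂ + ∑ i, c i * g i + l * r := by
  classical
  obtain ⟨G₁, h₁⟩ := exists_frob_eq (f ∘ₗ .inl ℝ _ _)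
  obtain ⟨G₂, h₂⟩ := exists_frob_eq (f ∘ₗ .inr ℝ _ _ ∘ₗ .inl ℝ _ _)
  let g := f ∘ₗ .inr ℝ _ _ ∘ₗ .inr ℝ _ _ ∘ₗ .inl ℝ _ _
  let l := f ∘ₗ .inr ℝ _ _ ∘ₗ .inr ℝ _ _ ∘ₗ .inr ℝ _ _
  refine ⟨G₁, G₂, fun i => g (Pi.single i 1), l 1, fun A B c r => ?_⟩
  have hg : g c = ∑ i, c i * g (Pi.single i 1) := by
    conv_lhs => rw [pi_eq_sum_univ' c]
    simp
  have hl : l r = l 1 * r := by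
    rw [mul_comm, ← smul_eq_mul, ← map_smul, smul_eq_mul, mul_one]
  rw [← h₁, ← h₂, ← hg, ← hl]
  simp only [g, l, LinearMap.comp_apply, LinearMap.inl_apply, LinearMap.inr_apply, ← map_add]
  simp

/-- A real number `κ` can be added to the dual objective at the cost of lowering the dual slack
by `κ`, by means of the multipliers of the two constraints on the total mass. -/
lemma exists_dualFeasible_of_slack_ge {i₁ i₂ : ι}
    (hε₁ : D.ε i₁ = -1) (hε₂ : D.ε i₂ = 1) (hTc₁ : D.Tc i₁ = 1) (hTc₂ : D.Tc i₂ = 1)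
    {Y₁ : Matrix (Fin m ⊕ Unit) (Fin m ⊕ Unit) ℝ} {Y₂ : Matrix (Fin m) (Fin m) ℝ} {y : ι → ℝ}
    (hY₁ : Y₁.PosSemidef) (hY₂ : Y₂.PosSemidef) (hy : ∀ i, 0 ≤ y i) {κ : ℝ}
    (hκ : ∀ t, κ ≤ D.objective t - frob (D.firstMoment t) Y₁ - frob (D.secondMoment t) Y₂
      - ∑ i, D.confFun i t * y i) :
    ∃ y', D.DualFeasible Y₁ Y₂ y' ∧ D.dualObjective Y₂ y' = D.dualObjective Y₂ y + κ := by
  classical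
  have hpm : κ⁺ - κ⁻ = κ := posPart_sub_negPart κ
  refine ⟨y + Pi.single i₂ κ⁺ + Pi.single i₁ κ⁻, ⟨hY₁, hY₂, fun i => ?_, fun t => ?_⟩, ?_⟩
  · have h₂ : 0 ≤ (Pi.single i₂ κ⁺ : ι → ℝ) := Pi.single_nonneg.2 (posPart_nonneg κ)
    have h₁ : 0 ≤ (Pi.single i₁ κ⁻ : ι → ℝ) := Pi.single_nonneg.2 (negPart_nonneg κ)
    exact add_nonneg (add_nonneg (hy i) (h₂ i)) (h₁ i)
  · have h₁ : D.confFun i₁ t = -1 := by simp [confFun, hε₁, hTc₁, Real.sign_of_neg]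
    have h₂ : D.confFun i₂ t = 1 := by simp [confFun, hε₂, hTc₂]
    simp only [Pi.add_apply, mul_add, Finset.sum_add_distrib, Pi.single_apply, mul_ite, mul_zero,
      Finset.sum_ite_eq', Finset.mem_univ, if_true, h₁, h₂]
    linarith [hκ t]
  · simp only [dualObjective, Pi.add_apply, mul_add, Finset.sum_add_distrib, Pi.single_apply,
      mul_ite, mul_zero, Finset.sum_ite_eq', Finset.mem_univ, if_true, hε₁, hε₂]
    linarith

/-- If the primal problem is feasible and all its feasible points have objective value above `w`,
then a hyperplane strictly separating the values at probability measures from `D.sublevel w`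
yields a dual feasible point with objective value `w`. -/
lemma exists_dualFeasible_dualObjective_eq [CompactSpace D.T] (hS : D.S.PosSemidef) {i₁ i₂ : ι}
    (hε₁ : D.ε i₁ = -1) (hε₂ : D.ε i₂ = 1) (hTc₁ : D.Tc i₁ = 1) (hTc₂ : D.Tc i₂ = 1)
    {P₀ : Measure D.T} (hP₀ : D.PrimalFeasible P₀) {w : ℝ}
    (hw : ∀ P, D.PrimalFeasible P → w < ∫ t, D.objective t ∂P) :
    ∃ Y₁ Y₂ y, D.DualFeasible Y₁ Y₂ y ∧ D.dualObjective Y₂ y = w := by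
  classical
  have hdisj : Disjoint (D.sublevel w)
      (Set.range fun P : ProbabilityMeasure D.T => D.momentMap P) := by
    rw [Set.disjoint_right]
    rintro _ ⟨P, rfl⟩ ⟨h₁, h₂, h₃, h₄⟩
    exact (hw P ⟨inferInstance, h₁, h₂, h₃⟩).not_ge h₄
  obtain ⟨f, u, v, hfu, huv, hfv⟩ := geometric_hahn_banach_closed_compact (D.convex_sublevel w)
    (D.isClosed_sublevel w) D.convex_momentMap D.isCompact_momentMap hdisj
  obtain ⟨G₁, G₂, g, l, hf⟩ := exists_coordinates f.toLinearMap
  replace hf : ∀ A B c r, f (A, B, c, r) = frob A G₁ + frob B G₂ + ∑ i, c i * g i + l * r := hf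
  have hC (P : Measure D.T) (hP : IsProbabilityMeasure P) : v < f (D.momentMap P) :=
    hfv _ ⟨⟨P, hP⟩, rfl⟩
  -- The functional is not vertical: the values at `P₀` meet the constraints, so lowering the
  -- last coordinate to `w` leads into the sublevel set.
  have hl : 0 < l := by
    have h₁ := hC P₀ (hP₀.isProbabilityMeasure hε₁ hε₂ hTc₁ hTc₂)
    have h₂ := hfu (matIntegral D.firstMoment P₀, matIntegral D.secondMoment P₀,
      fun i => ∫ t, D.confFun i t ∂P₀, w) ⟨hP₀.2.1, hP₀.2.2.1, hP₀.2.2.2, le_rfl⟩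
    rw [momentMap, hf] at h₁
    rw [hf] at h₂
    have h₃ := hw P₀ hP₀
    by_contra! hl
    have h₄ := mul_nonpos_of_nonpos_of_nonneg hl (sub_nonneg.2 h₃.le)
    rw [mul_sub] at h₄
    linarith
  -- The recession directions of the sublevel set show that the multipliers lie in the dual cones.
  have hG₁ (A : Matrix (Fin m ⊕ Unit) (Fin m ⊕ Unit) ℝ) (hA : A.PosSemidef) :
      frob A G₁ ≤ 0 := by
    refine nonpos_of_forall_add_mul_lt (u := u)
      (a := frob (-(D.εS • D.S)) G₂ + ∑ i, D.ε i * g i + l * w) fun s hs => ?_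
    have := hfu (s • A, -(D.εS • D.S), D.ε, w)
      ⟨hA.smul hs, by simpa using PosSemidef.zero, fun i => le_rfl, le_rfl⟩
    rw [hf, frob_smul_left] at this
    linarith
  have hG₂ (A : Matrix (Fin m) (Fin m) ℝ) (hA : A.PosSemidef) : frob A G₂ ≤ 0 := by
    refine nonpos_of_forall_add_mul_lt (u := u)
      (a := frob 0 G₁ + frob (-(D.εS • D.S)) G₂ + ∑ i, D.ε i * g i + l * w) fun s hs => ?_
    have := hfu (0, s • A + -(D.εS • D.S), D.ε, w)
      ⟨.zero, by simpa using hA.smul hs, fun i => le_rfl, le_rfl⟩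
    rw [hf, frob_add_left, frob_smul_left] at this
    linarith
  have hg (i : ι) : g i ≤ 0 := by
    refine nonpos_of_forall_add_mul_lt (u := u)
      (a := frob 0 G₁ + frob (-(D.εS • D.S)) G₂ + ∑ i, D.ε i * g i + l * w) fun s hs => ?_
    have := hfu (0, -(D.εS • D.S), D.ε + Pi.single i s, w)
      ⟨.zero, by simpa using PosSemidef.zero,
        fun j => le_add_of_nonneg_right (Pi.single_nonneg (α := fun _ : ι => ℝ).2 hs j), le_rfl⟩
    rw [hf] at this
    simp only [Pi.add_apply, add_mul, Finset.sum_add_distrib, Pi.single_apply, ite_mul, zero_mul,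
      Finset.sum_ite_eq', Finset.mem_univ, if_true] at this
    linarith
  have hc : 0 ≤ (2 * l)⁻¹ := by positivity
  have hY₁ := (posSemidef_add_transpose_of_frob_nonneg (G := -G₁) fun A hA => by
    rw [frob_comm, frob_neg_left, frob_comm]; linarith [hG₁ A hA]).smul hc
  have hY₂ := (posSemidef_add_transpose_of_frob_nonneg (G := -G₂) fun A hA => by
    rw [frob_comm, frob_neg_left, frob_comm]; linarith [hG₂ A hA]).smul hc
  have hsymm {n : Type} [Fintype n] {A G : Matrix n n ℝ} (hA : A.IsHermitian) :
      frob A ((2 * l)⁻¹ • (-G + (-G)ᵀ)) = -(l⁻¹ * frob A G) := by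
    rw [frob_smul_right, frob_add_right, frob_transpose_right hA, frob_comm, frob_neg_left,
      frob_comm]
    field_simp
    ring
  have hsum (c : ι → ℝ) : ∑ i, c i * (-(l⁻¹ * g i)) = -(l⁻¹ * ∑ i, c i * g i) := by
    rw [Finset.mul_sum, ← Finset.sum_neg_distrib]
    exact Finset.sum_congr rfl fun i _ => by ring
  have hy (i : ι) : 0 ≤ -(l⁻¹ * g i) := by
    have := mul_nonneg (inv_nonneg.2 hl.le) (neg_nonneg.2 (hg i))
    linarith
  obtain ⟨y, hfeas, hobj⟩ := exists_dualFeasible_of_slack_ge hε₁ hε₂ hTc₁ hTc₂ hY₁ hY₂ hy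
    (κ := w - D.dualObjective ((2 * l)⁻¹ • (-G₂ + (-G₂)ᵀ)) fun i => -(l⁻¹ * g i)) fun t => by
      -- Evaluating the functional at the Dirac measure at `t`.
      have h₁ := hC (Measure.dirac t) inferInstance
      have h₂ := hfu (0, -(D.εS • D.S), D.ε, w)
        ⟨.zero, by simpa using PosSemidef.zero, fun i => le_rfl, le_rfl⟩
      rw [momentMap, hf] at h₁
      rw [hf, frob_neg_left, frob_smul_left, show frob 0 G₁ = 0 by simp [frob]] at h₂
      simp only [integral_dirac, matIntegral] at h₁
      rw [dualObjective, hsymm (D.isHermitian_firstMoment hS t),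
        hsymm (D.isHermitian_secondMoment t), hsymm hS.1, hsum, hsum]
      have h₃ := mul_lt_mul_of_pos_left ((h₂.trans huv).trans h₁) (inv_pos.2 hl)
      simp only [mul_add, inv_mul_cancel_left₀ hl.ne'] at h₃
      change _ < l⁻¹ * frob (D.firstMoment t) G₁ + l⁻¹ * frob (D.secondMoment t) G₂ + _ + _ at h₃
      linarith
  exact ⟨_, _, y, hfeas, by rw [hobj]; ring⟩

end StrongDuality

end Data

end MomentDRO

/-! ### The duality gap is zero -/

theorem mainTheorem3 {m k : ℕ} {ι : Type*} [Fintype ι] (D : MomentDRO.Data m k ι)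
    -- standing assumptions on the nominal data
    (hT : IsCompact D.T) (hS : D.S.PosSemidef) (hεμ : 0 < D.εμ) (hεS : 1 ≤ D.εS)
    -- upper / lower continuous approximation of the indicator functions
    (hX : ∀ i, (0 ≤ D.x i → MomentDRO.IsUpperApprox (D.Xc i) (D.X i)) ∧
      (D.x i < 0 → MomentDRO.IsLowerApprox (D.Xc i) (D.X i)))
    (hC : ∀ i, (0 ≤ D.ε i → MomentDRO.IsLowerApprox (D.Tc i) (D.confSet i)) ∧
      (D.ε i < 0 → MomentDRO.IsUpperApprox (D.Tc i) (D.confSet i)))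
    -- two of the confidence constraints express that `P` has total mass one
    (i₁ i₂ : ι) (hT₁ : D.confSet i₁ = D.T) (hT₂ : D.confSet i₂ = D.T)
    (hε₁ : D.ε i₁ = -1) (hε₂ : D.ε i₂ = 1) (hTc₁ : D.Tc i₁ = 1) (hTc₂ : D.Tc i₂ = 1)
    -- the Gaussian measure on `T` is strictly positive and feasible
    (hpos : MeasureTheory.Measure.IsOpenPosMeasure D.gaussianOn)
    (hfeas : D.PrimalFeasible D.gaussianOn) :
    ∃ v : ℝ, D.primalValue = (v : EReal) ∧ D.dualValue = (v : EReal) := by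
  have : CompactSpace D.T := isCompact_iff_compactSpace.1 hT
  have hle {P : Measure D.T} (hP : D.PrimalFeasible P) :
      D.primalValue ≤ ((∫ t, D.objective t ∂P : ℝ) : EReal) := iInf₂_le P hP
  have htop : D.primalValue ≠ ⊤ := ((hle hfeas).trans_lt (EReal.coe_lt_top _)).ne
  -- The objective function is bounded and all feasible measures are probability measures.
  have hbot : D.primalValue ≠ ⊥ := by
    obtain ⟨M, hM⟩ := (isCompact_range D.continuous_objective).bddBelow
    refine ((EReal.bot_lt_coe M).trans_le (le_iInf₂ fun P hP => EReal.coe_le_coe_iff.2 ?_)).ne'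
    have := hP.isProbabilityMeasure hε₁ hε₂ hTc₁ hTc₂
    calc M = ∫ _, M ∂P := by simp
      _ ≤ ∫ t, D.objective t ∂P := integral_mono (integrable_const M)
          (MomentDRO.Data.integrable_of_continuous D.continuous_objective)
          fun t => hM (Set.mem_range_self t)
  refine ⟨D.primalValue.toReal, (EReal.coe_toReal htop hbot).symm, ?_⟩
  rw [EReal.coe_toReal htop hbot]
  apply le_antisymm
  · exact iSup_le fun Y₁ => iSup_le fun Y₂ => iSup₂_le fun y hY => le_iInf₂ fun P hP =>
      EReal.coe_le_coe_iff.2 (MomentDRO.Data.dualObjective_le_integral_objective hP hY)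
  · refine le_of_forall_lt fun c hc => ?_
    obtain ⟨w, hcw, hw⟩ := EReal.lt_iff_exists_real_btwn.1 hc
    obtain ⟨Y₁, Y₂, y, hY, rfl⟩ := MomentDRO.Data.exists_dualFeasible_dualObjective_eq hS
      hε₁ hε₂ hTc₁ hTc₂ hfeas fun P hP => EReal.coe_lt_coe_iff.1 (hw.trans_le (hle hP))
    exact hcw.trans_le (le_iSup_of_le Y₁ <| le_iSup_of_le Y₂ <| le_iSup₂_of_le y hY le_rfl)
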